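/- Let $V$ be a separable reflexive real Banach space with dual $V^*$, and let $T>0$. Let $\mathcal E:[0,T]\times V\to(-\infty,+\infty]$ have domain $[0,T]\times D$ for some $D\subset V$, write $\mathcal G(u)=\sup_{t\in[0,T]}\mathcal E_t(u)$, let $\mathrm F:[0,T]\times D\rightrightarrows V^*$ be a multivalued map with graph $\{(t,u,\xi):\xi\in \mathrm F_t(u)\}$, let $\mathrm P:\mathrm{graph}(\mathrm F)\to\mathbb R$, and let $\Psi_u:V\to[0,+\infty)$, $u\in D$, be functions with Fenchel conjugates $\Psi_u^*$ and convex subdifferentials $\partial\Psi_u$. Assume on $\Psi$: (i) for every $u\in D$, $\Psi_u$ is convex and lower semicontinuous, $\Psi_u(0)=0$, $\Psi_u(v)/\|v\|\to+\infty$ as $\|v\|\to\infty$, $\Psi_u^*(\xi)/\|\xi\|_*\to+\infty$ as $\|\xi\|_*\to\infty$, and $\Psi_u^*(w_1)=\Psi_u^*(w_2)$ whenever $w_1,w_2\in\partial\Psi_u(v)$; (ii) for all $R,M>0$ there is $K>0$ such that for all $u\in D$ with $\mathcal G(u)\le R$: $\Psi_u(v)\ge M\|v\|$ if $\|v\|\ge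 K$, and $\Psi^*_u(\xi)\ge M\|\xi\|_*$ if $\|\xi\|_*\ge K$. Assume on $(\mathcal E,\mathrm F,\mathrm P)$: (E0) $\mathcal E_t$ is lower semicontinuous for every $t\in[0,T]$, $\mathcal E\ge C_0$ on $[0,T]\times D$ for some $C_0>0$, and $\mathrm{graph}(\mathrm F)$ is a Borel subset of $[0,T]\times V\times V^*$; (E1) for every $t\in[0,T]$ the sublevels of $\mathcal E_t$ are compact; (E2) if $t\in[0,T]$, $u_o\in D$, $\tau>0$ and $\bar u$ minimizes $u\mapsto\mathcal E_t(u)+\tau\Psi_{u_o}((u-u_o)/\tau)$ over $V$, then there is $\xi\in \mathrm F_t(\bar u)$ with $-\xi\in\partial\Psi_{u_o}((\bar u-u_o)/\tau)$; (E3) there is $C_1>0$ with $|\mathcal E_t(u)-\mathcal E_s(u)|\le C_1\mathcal E_t(u)|t-s|$ for all $u\in D$, $t,s\in[0,T]$; (E4) $\mathrm P$ is Borel and there is $C_2>0$ such that for all $(t,u,\xi)\in\mathrm{graph}(\mathrm F)$, $\mathrm P_t(u,\xi)\le C_2\,\mathcal G(u)$ and, if $t<T$, $\liminf_{h\downarrow0}\frac{\mathcal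 E_{t+h}(u)-\mathcal E_t(u)}h\le \mathrm P_t(u,\xi)$; (E5) for every $u\in \mathrm{AC}([0,T];V)$ and $\xi\in L^1(0,T;V^*)$ with $\sup_{t\in(0,T)}|\mathcal E_t(u(t))|<\infty$, $\xi(t)\in \mathrm F_t(u(t))$ for a.a. $t\in(0,T)$, $\int_0^T\Psi_{u(t)}(u'(t))\,dt<\infty$ and $\int_0^T\Psi^*_{u(t)}(-\xi(t))\,dt<\infty$ (the integrands being measurable), the map $t\mapsto\mathcal E_t(u(t))$ is absolutely continuous on $(0,T)$ and $\frac{d}{dt}\mathcal E_t(u(t))\ge\langle\xi(t),u'(t)\rangle+\mathrm P_t(u(t),\xi(t))$ for a.a. $t\in(0,T)$; (E6) for every $t\in[0,T]$, if $\xi_n\in \mathrm F_t(u_n)$, $u_n\to u$ in $V$, $\xi_n\rightharpoonup\xi$ weakly in $V^*$, $\mathrm P_t(u_n,\xi_n)\to p$ and $\mathcal E_t(u_n)\to e$ in $\mathbb R$, then $\xi\in \mathrm F_t(u)$, $p\le \mathrm P_t(u,\xi)$ and $e=\mathcal E_t(u)$. Let $u\in\mathrm{AC}([0,T];V)$ satisfy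 $\mathrm F_t(u(t))\neq\emptyset$ for a.a. $t\in(0,T)$ and $\sup_{t\in(0,T)}\mathcal E_t(u(t))<+\infty$. Let $\{\mu_t\}_{t\in(0,T)}$ be a Young measure in $V\times V^*\times\mathbb R$, i.e. a family of Borel probability measures such that $t\mapsto\mu_t(B)$ is Lebesgue measurable for every Borel set $B$, and suppose that $$\int_0^T\!\int_{V\times V^*\times\mathbb R}\big(\Psi_{u(t)}(v)+\Psi^*_{u(t)}(-\zeta)\big)\,d\mu_t(v,\zeta,p)\,dt<+\infty$$ (where $(t,v,\zeta)\mapsto\Psi_{u(t)}(v)+\Psi^*_{u(t)}(-\zeta)$ is measurable with respect to the product of the Lebesgue $\sigma$-algebra of $(0,T)$ and the Borel $\sigma$-algebra of $V\times V^*$, possibly after removing a null set of times), that $u'(t)=\int v\,d\mu_t(v,\zeta,p)$ for a.a. $t\in(0,T)$, and that for a.a. $t\in(0,T)$ every $(v,\xi,p)\in\mathrm{supp}(\mu_t)$ satisfies $\xi\in \mathrm F_t(u(t))$ and $p\le \mathrm P_t(u(t),\xi)$. Then $t\mapsto\mathcal E_t(u(t))$ is absolutely continuous on $(0,T)$ (hence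 differentiable a.e.), and for a.a. $t\in(0,T)$ $$\frac{d}{dt}\mathcal E_t(u(t))\;\ge\;\int_{V\times V^*\times\mathbb R}\big(\langle u'(t),\zeta\rangle+p\big)\,d\mu_t(v,\zeta,p),$$ where the positive part of the integrand has finite integral, so that the right-hand side is well defined in $[-\infty,+\infty)$. -/

import Mathlib

open Set Filter Topology MeasureTheory

noncomputable section

/-- Reflexivity: the canonical embedding `V → V**` is onto. -/
def IsReflexiveSpace (V : Type*) [NormedAddCommGroup V] [NormedSpace ℝ V] : Prop :=
  Function.Surjective (NormedSpace.inclusionInDoubleDual ℝ V)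

/-- The Fenchel–Moreau conjugate `Ψ*(ξ) = sup_v (⟨ξ, v⟩ - Ψ(v))`, with values in `[-∞, +∞]`. -/
def fenchelConj {V : Type*} [NormedAddCommGroup V] [NormedSpace ℝ V]
    (Ψ : V → ℝ) (ξ : StrongDual ℝ V) : EReal :=
  ⨆ v : V, ((ξ v - Ψ v : ℝ) : EReal)

/-- The subdifferential of convex analysis. -/
def convexSubdiff {V : Type*} [NormedAddCommGroup V] [NormedSpace ℝ V]
    (Ψ : V → ℝ) (v : V) : Set (StrongDual ℝ V) :=
  {w | ∀ z, Ψ v + w (z - v) ≤ Ψ z}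

/-- Admissible dissipation potentials `Ψ : V → [0, +∞)`. -/
structure IsAdmissiblePotential {V : Type*} [NormedAddCommGroup V] [NormedSpace ℝ V]
    (Ψ : V → ℝ) : Prop where
  nonneg : ∀ v, 0 ≤ Ψ v
  lsc : LowerSemicontinuous Ψ
  convex : ConvexOn ℝ univ Ψ
  zero : Ψ 0 = 0
  superlinear : ∀ M : ℝ, ∃ K : ℝ, ∀ v : V, K ≤ ‖v‖ → M * ‖v‖ ≤ Ψ v
  conj_superlinear : ∀ M : ℝ, ∃ K : ℝ, ∀ ξ : StrongDual ℝ V, K ≤ ‖ξ‖ →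
    ((M * ‖ξ‖ : ℝ) : EReal) ≤ fenchelConj Ψ ξ
  conj_const : ∀ v, ∀ w₁ ∈ convexSubdiff Ψ v, ∀ w₂ ∈ convexSubdiff Ψ v,
    fenchelConj Ψ w₁ = fenchelConj Ψ w₂

/-- `sup_{t ∈ [0,T]} E_t(u)`. -/
def supEnergy {V : Type*} (T : ℝ) (E : ℝ → V → EReal) (u : V) : EReal :=
  ⨆ t ∈ Icc (0 : ℝ) T, E t u

/-- The (real) energy `t ↦ E_t(u(t))` along a curve on which the energy is finite. -/
def energyAlong {V : Type*} (E : ℝ → V → EReal) (u : ℝ → V) (t : ℝ) : ℝ :=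
  (E t (u t)).toReal

/-- The graph of a multivalued map `F : [0,T] × D ⇉ V*`, which is encoded as a map on `ℝ × V`
with empty values outside `[0,T] × D`. -/
def multiGraph {V : Type*} [NormedAddCommGroup V] [NormedSpace ℝ V]
    (F : ℝ → V → Set (StrongDual ℝ V)) : Set (ℝ × V × StrongDual ℝ V) :=
  {q | q.2.2 ∈ F q.1 q.2.1}

/-- Absolute continuity on the open interval `(a, b)`: the usual `ε`-`δ` condition on finite
families of disjoint intervals with end points in `(a, b)`. -/
def AbsContOnIoo (f : ℝ → ℝ) (a b : ℝ) : Prop :=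
  ∀ ε > (0 : ℝ), ∃ δ > (0 : ℝ), ∀ (n : ℕ) (I : ℕ → ℝ × ℝ),
    (∀ i < n, (I i).1 ∈ Ioo a b ∧ (I i).2 ∈ Ioo a b) →
    (Finset.range n : Set ℕ).PairwiseDisjoint (fun i => uIoc (I i).1 (I i).2) →
    ∑ i ∈ Finset.range n, dist (I i).1 (I i).2 < δ →
    ∑ i ∈ Finset.range n, dist (f (I i).1) (f (I i).2) < ε

/-- A (Lebesgue) measurable `[0, +∞]`-valued function with finite integral over `(0, T)`. -/
def HasFiniteTimeIntegral (T : ℝ) (f : ℝ → ENNReal) : Prop :=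
  AEMeasurable f (volume.restrict (Ioo 0 T)) ∧ ∫⁻ t in Ioo 0 T, f t < ⊤

/-- The integral in the extended sense, `∫ f⁺ - ∫ f⁻ ∈ [-∞, +∞]`; it is meaningful as soon as one
of the two terms is finite. -/
def extIntegral {α : Type*} [MeasurableSpace α] (μ : Measure α) (f : α → ℝ) : EReal :=
  ((∫⁻ x, ENNReal.ofReal (f x) ∂μ : ENNReal) : EReal)
    - ((∫⁻ x, ENNReal.ofReal (-f x) ∂μ : ENNReal) : EReal)

/-- The family `(Ψ_u)_{u ∈ D}` consists of admissible dissipation potentials, and `Ψ_u`, `Ψ_u*`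
have superlinear growth, uniformly on the sublevels of `sup_t E_t`. -/
structure DissipationAssumptions {V : Type*} [NormedAddCommGroup V] [NormedSpace ℝ V]
    (T : ℝ) (D : Set V) (E : ℝ → V → EReal) (Ψ : V → V → ℝ) : Prop where
  admissible : ∀ u ∈ D, IsAdmissiblePotential (Ψ u)
  superlinear : ∀ R > (0 : ℝ), ∀ M > (0 : ℝ), ∃ K > (0 : ℝ), ∀ u ∈ D, supEnergy T E u ≤ (R : EReal) →
    ∀ v : V, K ≤ ‖v‖ → M * ‖v‖ ≤ Ψ u v
  conj_superlinear : ∀ R > (0 : ℝ), ∀ M > (0 : ℝ), ∃ K > (0 : ℝ), ∀ u ∈ D,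
    supEnergy T E u ≤ (R : EReal) → ∀ ξ : StrongDual ℝ V, K ≤ ‖ξ‖ →
      ((M * ‖ξ‖ : ℝ) : EReal) ≤ fenchelConj (Ψ u) ξ

/-- The chain-rule inequality of `E` with respect to the triple `(Ψ, F, P)`. Since the energy is
bounded below by a positive constant, boundedness along the curve is boundedness from above. -/
def ChainRuleInequality {V : Type*} [NormedAddCommGroup V] [NormedSpace ℝ V]
    (T : ℝ) (E : ℝ → V → EReal) (Ψ : V → V → ℝ)
    (F : ℝ → V → Set (StrongDual ℝ V)) (P : ℝ → V → StrongDual ℝ V → ℝ) : Prop :=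
  ∀ (u : ℝ → V) (ξ : ℝ → StrongDual ℝ V),
    AbsolutelyContinuousOnInterval u 0 T →
    Integrable ξ (volume.restrict (Ioo 0 T)) →
    (∃ S : ℝ, ∀ t ∈ Ioo 0 T, E t (u t) ≤ (S : EReal)) →
    (∀ᵐ t ∂(volume.restrict (Ioo 0 T)), ξ t ∈ F t (u t)) →
    HasFiniteTimeIntegral T (fun t => ENNReal.ofReal (Ψ (u t) (deriv u t))) →
    HasFiniteTimeIntegral T (fun t => (fenchelConj (Ψ (u t)) (-ξ t)).toENNReal) →
    AbsContOnIoo (energyAlong E u) 0 T ∧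
      ∀ᵐ t ∂(volume.restrict (Ioo 0 T)),
        ξ t (deriv u t) + P t (u t) (ξ t) ≤ deriv (energyAlong E u) t

/-- The assumptions on the energy `E : [0,T] × V → (-∞, +∞]` with domain `[0,T] × D`, its
subdifferential `F : [0,T] × D ⇉ V*` and its generalized time derivative `P : graph F → ℝ`.
Values of `E` at times outside `[0,T]`, and of `P` outside the graph of `F`, play no role. -/
structure EnergyAssumptions {V : Type*} [NormedAddCommGroup V] [NormedSpace ℝ V]
    [MeasurableSpace V]
    (T : ℝ) (D : Set V) (E : ℝ → V → EReal) (Ψ : V → V → ℝ)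
    (F : ℝ → V → Set (StrongDual ℝ V)) (P : ℝ → V → StrongDual ℝ V → ℝ) : Prop where
  dom_energy : ∀ t ∈ Icc 0 T, {u | E t u < ⊤} = D
  dom_subdiff : ∀ t u, (F t u).Nonempty → t ∈ Icc 0 T ∧ u ∈ D
  lsc : ∀ t ∈ Icc 0 T, LowerSemicontinuous (E t)
  bounded_below : ∃ C₀ > (0 : ℝ), ∀ t ∈ Icc 0 T, ∀ u ∈ D, (C₀ : EReal) ≤ E t u
  graph_borel : MeasurableSet (multiGraph F)
  coercive : ∀ t ∈ Icc 0 T, ∀ R : ℝ, IsCompact {u | E t u ≤ (R : EReal)}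
  sum_rule : ∀ t ∈ Icc 0 T, ∀ u₀ ∈ D, ∀ τ > (0 : ℝ), ∀ w : V,
    (∀ z : V, E t w + ((τ * Ψ u₀ (τ⁻¹ • (w - u₀)) : ℝ) : EReal)
      ≤ E t z + ((τ * Ψ u₀ (τ⁻¹ • (z - u₀)) : ℝ) : EReal)) →
    ∃ ξ ∈ F t w, -ξ ∈ convexSubdiff (Ψ u₀) (τ⁻¹ • (w - u₀))
  lipschitz : ∃ C₁ > (0 : ℝ), ∀ u ∈ D, ∀ t ∈ Icc 0 T, ∀ s ∈ Icc 0 T,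
    |(E t u).toReal - (E s u).toReal| ≤ C₁ * (E t u).toReal * |t - s|
  time_deriv_borel : Measurable
    (fun q : multiGraph F => P q.1.1 q.1.2.1 q.1.2.2)
  time_deriv_lower : ∀ t u, ∀ ξ ∈ F t u, t < T →
    liminf (fun h : ℝ => ((((E (t + h) u).toReal - (E t u).toReal) / h : ℝ) : EReal)) (𝓝[>] 0)
      ≤ (P t u ξ : EReal)
  time_deriv_upper : ∃ C₂ > (0 : ℝ), ∀ t u, ∀ ξ ∈ F t u,
    (P t u ξ : EReal) ≤ (C₂ : EReal) * supEnergy T E u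
  chain_rule : ChainRuleInequality T E Ψ F P
  -- strong convergence of `u n`, weak convergence in `V*` of `ξ n`
  weakly_closed : ∀ t ∈ Icc 0 T, ∀ (u : ℕ → V) (ξ : ℕ → StrongDual ℝ V)
    (u' : V) (ξ' : StrongDual ℝ V) (p' e' : ℝ),
    (∀ n, ξ n ∈ F t (u n)) →
    Tendsto u atTop (𝓝 u') →
    (∀ φ : StrongDual ℝ (StrongDual ℝ V), Tendsto (fun n => φ (ξ n)) atTop (𝓝 (φ ξ'))) →
    Tendsto (fun n => P t (u n) (ξ n)) atTop (𝓝 p') →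
    Tendsto (fun n => E t (u n)) atTop (𝓝 (e' : EReal)) →
    ξ' ∈ F t u' ∧ p' ≤ P t u' ξ' ∧ (e' : EReal) = E t u'

/-- A Young measure on `(0,T)`: Borel probability measures `μ t`, `t ∈ (0,T)`, such that
`t ↦ μ t B` is Lebesgue measurable on `(0,T)` for every Borel set `B`. -/
structure IsYoungMeasure {W : Type*} [MeasurableSpace W] (T : ℝ) (μ : ℝ → Measure W) : Prop where
  prob : ∀ t ∈ Ioo 0 T, IsProbabilityMeasure (μ t)
  meas : ∀ B : Set W, MeasurableSet B → AEMeasurable (fun t => μ t B) (volume.restrict (Ioo 0 T))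

/-- The integrand `(t, (v, ζ, p)) ↦ Ψ_{u(t)}(v) + Ψ*_{u(t)}(-ζ) ∈ [0, +∞]`. -/
def dissipationIntegrand {V : Type*} [NormedAddCommGroup V] [NormedSpace ℝ V]
    (Ψ : V → V → ℝ) (u : ℝ → V) (t : ℝ) (w : V × StrongDual ℝ V × ℝ) : ENNReal :=
  ENNReal.ofReal (Ψ (u t) w.1) + (fenchelConj (Ψ (u t)) (-w.2.1)).toENNReal

end

/-! The Young measure is disintegrated into ordinary selections. `V × V* × ℝ` is standard Borel, so
for a.a. `t` the measure `μ t` is the law of `f t` under Lebesgue measure on `[0,1]`, with `f`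
jointly measurable (`IsYoungMeasure.exists_measurable_map_eq`). By Fubini, for a.e. `s` the
component `ξ_s(t)` of `f t s` in `V*` is a selection of `F t (u t)` with finite dual dissipation,
and superlinearity makes it integrable. Jensen's inequality at the barycentre `u'(t)` gives `∫
Ψ_u(u') < ∞`.

The assumed chain rule then applies to each pair `(u, ξ_s)`. Its right-hand side, the derivative of
the energy along `u`, does not depend on `s`. Exchanging "a.e. `s`" and "a.e. `t`" bounds the
integrand by this derivative `μ t`-a.e., which is stronger than the integrated inequality. -/

/-! ### Separability of the dual of a reflexive space. -/

/-- A normed space whose dual is separable is separable. -/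
theorem separableSpace_of_strongDual {X : Type*} [NormedAddCommGroup X] [NormedSpace ℝ X]
    [TopologicalSpace.SeparableSpace (StrongDual ℝ X)] : TopologicalSpace.SeparableSpace X := by
  let f := TopologicalSpace.denseSeq (StrongDual ℝ X)
  have hx : ∀ n, ∃ x : X, ‖x‖ ≤ 1 ∧ ‖f n‖ / 2 ≤ ‖f n x‖ := by
    intro n
    rcases eq_or_ne (f n) 0 with h | h
    · exact ⟨0, by simp, by simp [h]⟩
    · obtain ⟨x, hx1, hx2⟩ := (f n).exists_lt_apply_of_lt_opNorm
        (half_lt_self (norm_pos_iff.2 h))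
      exact ⟨x, hx1.le, hx2.le⟩
  choose x hx1 hx2 using hx
  set S : Submodule ℝ X := Submodule.span ℝ (range x)
  have hS : TopologicalSpace.IsSeparable (closure (S : Set X)) :=
    ((countable_range x).isSeparable.span).closure
  suffices h : closure (S : Set X) = univ by
    rw [h] at hS
    exact TopologicalSpace.isSeparable_univ_iff.1 hS
  by_contra hne
  obtain ⟨z, hz⟩ := (ne_univ_iff_exists_notMem _).1 hne
  obtain ⟨g, s, hgs, hsz⟩ := geometric_hahn_banach_closed_point S.convex.closure
    isClosed_closure hz
  have hs : 0 < s := by simpa using hgs 0 (subset_closure S.zero_mem)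
  have hg0 : ∀ a ∈ S, g a = 0 := by
    -- A functional bounded above on a subspace vanishes there: rescaling `a` would make it attain
    -- the bound `s`.
    intro a ha
    by_contra h
    have := hgs ((s / g a) • a) (subset_closure (S.smul_mem _ ha))
    rw [map_smul, smul_eq_mul, div_mul_cancel₀ _ h] at this
    exact lt_irrefl _ this
  have hg : 0 < ‖g‖ := by
    refine norm_pos_iff.2 fun h => ?_
    simp only [h, zero_apply] at hsz
    linarith
  -- As `g` vanishes at `x n`, `‖f n‖ / 2 ≤ ‖g - f n‖`, so `‖g‖ ≤ 3 ‖g - f n‖ < (3/4) ‖g‖`.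
  obtain ⟨n, hn⟩ := (TopologicalSpace.denseRange_denseSeq (StrongDual ℝ X)).exists_dist_lt g
    (by positivity : 0 < ‖g‖ / 4)
  change dist g (f n) < _ at hn
  rw [dist_eq_norm] at hn
  have h1 : ‖f n (x n)‖ ≤ ‖g - f n‖ := by
    have h2 : (g - f n) (x n) = - f n (x n) := by
      simp [hg0 (x n) (Submodule.subset_span (mem_range_self n))]
    rw [← norm_neg, ← h2]
    exact (g - f n).unit_le_opNorm _ (hx1 n)
  have h3 : ‖g‖ ≤ ‖g - f n‖ + ‖f n‖ := by simpa using norm_add_le (g - f n) (f n)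
  linarith [hx2 n]

/-- `V**` is a continuous image of `V`. Separability of `V*` makes `V × V* × ℝ` Polish, with Borel
sets generated by products. -/
theorem IsReflexiveSpace.separableSpace_strongDual {X : Type*} [NormedAddCommGroup X]
    [NormedSpace ℝ X] [TopologicalSpace.SeparableSpace X] (hX : IsReflexiveSpace X) :
    TopologicalSpace.SeparableSpace (StrongDual ℝ X) := by
  have : TopologicalSpace.SeparableSpace (StrongDual ℝ (StrongDual ℝ X)) :=
    hX.denseRange.separableSpace (NormedSpace.inclusionInDoubleDual ℝ X).continuous
  exact separableSpace_of_strongDual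

/-! ### Young measures as laws of random variables. -/

/-- A family of probability measures whose values on measurable sets are a.e. measurable agrees
almost everywhere with a Markov kernel. -/
theorem exists_markovKernel_ae_eq {α Y : Type*} [MeasurableSpace α] [MeasurableSpace Y]
    [StandardBorelSpace Y] [Nonempty Y] {ν : Measure α} {μ : α → Measure Y}
    (hprob : ∀ᵐ a ∂ν, IsProbabilityMeasure (μ a))
    (hmeas : ∀ B, MeasurableSet B → AEMeasurable (fun a => μ a B) ν) :
    ∃ κ : ProbabilityTheory.Kernel α Y, ProbabilityTheory.IsMarkovKernel κ ∧
      ∀ᵐ a ∂ν, κ a = μ a := by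
  have he := measurableEmbedding_embeddingReal Y
  -- A countable generating π-system, so that a single null set of parameters serves all its
  -- members.
  let Q : ℚ → Set Y := fun q => embeddingReal Y ⁻¹' Iic (q : ℝ)
  have hQ : ∀ q, MeasurableSet (Q q) := fun q => he.measurable measurableSet_Iic
  have hgen : (inferInstance : MeasurableSpace Y) = .generateFrom (range Q) := by
    have h1 := he.comap_eq
    rw [BorelSpace.measurable_eq (α := ℝ), Real.borel_eq_generateFrom_Iic_rat,
      MeasurableSpace.comap_generateFrom] at h1
    rw [← h1]
    rw [image_iUnion]
    simp only [image_singleton, iUnion_singleton_eq_range, Q]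
  have hpi : IsPiSystem (range Q) := by
    rintro _ ⟨p, rfl⟩ _ ⟨q, rfl⟩ -
    refine ⟨min p q, ?_⟩
    ext y
    simp [Q, Rat.cast_min]
  have hae : ∀ᵐ a ∂ν, IsProbabilityMeasure (μ a) ∧
      ∀ q, μ a (Q q) = (hmeas (Q q) (hQ q)).mk _ a :=
    hprob.and (ae_all_iff.2 fun q => (hmeas (Q q) (hQ q)).ae_eq_mk)
  obtain ⟨N, hN, hNm, hN0⟩ := exists_measurable_superset_of_null (ae_iff.1 hae)
  have hgood : ∀ a, a ∉ N → IsProbabilityMeasure (μ a) ∧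
      ∀ q, μ a (Q q) = (hmeas (Q q) (hQ q)).mk _ a := fun a ha => by
    by_contra h
    exact ha (hN h)
  classical
  let y : Y := Classical.arbitrary Y
  let κ : α → Measure Y := fun a => if a ∈ N then Measure.dirac y else μ a
  have hκ : ∀ a, IsProbabilityMeasure (κ a) := by
    intro a
    by_cases ha : a ∈ N
    · simp only [κ, if_pos ha]; infer_instance
    · simp only [κ, if_neg ha]; exact (hgood a ha).1
  have hκm : Measurable κ := by
    refine .measure_of_isPiSystem_of_isProbabilityMeasure hgen hpi ?_
    rintro _ ⟨q, rfl⟩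
    have : (fun a => κ a (Q q)) =
        fun a => if a ∈ N then Measure.dirac y (Q q) else (hmeas (Q q) (hQ q)).mk _ a := by
      funext a
      by_cases ha : a ∈ N
      · simp only [κ, if_pos ha]
      · simp only [κ, if_neg ha, (hgood a ha).2 q]
    rw [this]
    exact Measurable.ite hNm measurable_const (hmeas (Q q) (hQ q)).measurable_mk
  refine ⟨⟨κ, hκm⟩, ⟨hκ⟩, ?_⟩
  filter_upwards [measure_eq_zero_iff_ae_notMem.1 hN0] with a ha
  exact if_neg ha

/-- A Young measure is, at almost all times, the law of a jointly measurable random variable. -/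
theorem IsYoungMeasure.exists_measurable_map_eq {W : Type*} [MeasurableSpace W]
    [StandardBorelSpace W] [Nonempty W] {T : ℝ} {μ : ℝ → Measure W} (hμ : IsYoungMeasure T μ) :
    ∃ f : ℝ → unitInterval → W, Measurable (Function.uncurry f) ∧
      ∀ᵐ t ∂(volume.restrict (Ioo 0 T)), volume.map (f t) = μ t := by
  obtain ⟨κ, hκ, hκμ⟩ := exists_markovKernel_ae_eq
    ((ae_restrict_iff' measurableSet_Ioo).2 (ae_of_all _ hμ.prob)) hμ.meas
  obtain ⟨f, hf, hfκ⟩ := κ.exists_measurable_map_eq_unitInterval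
  refine ⟨f, hf, ?_⟩
  filter_upwards [hκμ] with t ht
  rw [hfκ, ht]

/-! ### Jensen's inequality, absolute continuity and extended integrals. -/

/-- Jensen's inequality for a convex lower semicontinuous function on a Banach space. -/
theorem ConvexOn.ofReal_map_integral_le {X Ω : Type*} [NormedAddCommGroup X] [NormedSpace ℝ X]
    [CompleteSpace X] [MeasurableSpace Ω] {ν : Measure Ω} [IsProbabilityMeasure ν] {φ : X → ℝ}
    (hφ : ConvexOn ℝ univ φ) (hlsc : LowerSemicontinuous φ) {f : Ω → X} (hf : Integrable f ν) :
    ENNReal.ofReal (φ (∫ x, f x ∂ν)) ≤ ∫⁻ x, ENNReal.ofReal (φ (f x)) ∂ν := by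
  refine le_of_forall_lt_imp_le_of_dense fun b hb => ?_
  have hbtop : b ≠ ⊤ := (hb.trans ENNReal.ofReal_lt_top).ne
  rw [ENNReal.lt_ofReal_iff_toReal_lt hbtop] at hb
  -- An affine minorant of `φ` with value exactly `b.toReal` at the mean.
  obtain ⟨l, c, hle, heq⟩ := hφ.exists_affine_le_of_lt (𝕜 := ℝ) (mem_univ _) hb isClosed_univ
    (hlsc.lowerSemicontinuousOn _)
  have hle' : ∀ x, l x + c ≤ φ x := fun x => by simpa using hle ⟨x, mem_univ x⟩
  simp only [RCLike.re_to_real] at heq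
  have hint : Integrable (fun x => l (f x) + c) ν :=
    (l.integrable_comp hf).add (integrable_const c)
  have h1 : ∫ x, l (f x) + c ∂ν = b.toReal := by
    rw [integral_add (l.integrable_comp hf) (integrable_const c), l.integral_comp_comm hf, ← heq]
    simp
  have h2 := integral_eq_lintegral_pos_part_sub_lintegral_neg_part hint
  rw [h1] at h2
  have hfin : ∫⁻ x, ENNReal.ofReal (l (f x) + c) ∂ν ≠ ⊤ := by
    refine ((lintegral_mono fun x => ?_).trans_lt hint.2).ne
    exact Real.ofReal_le_enorm _
  calc b ≤ ∫⁻ x, ENNReal.ofReal (l (f x) + c) ∂ν := by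
        rw [← ENNReal.toReal_le_toReal hbtop hfin, h2]
        exact sub_le_self _ ENNReal.toReal_nonneg
    _ ≤ _ := lintegral_mono fun x => ENNReal.ofReal_le_ofReal (hle' _)

/-- Countably many compact intervals with rational end points exhaust `(a, b)`. -/
theorem AbsContOnIoo.ae_differentiableAt {f : ℝ → ℝ} {a b : ℝ} (hf : AbsContOnIoo f a b) :
    ∀ᵐ x ∂(volume.restrict (Ioo a b)), DifferentiableAt ℝ f x := by
  have h : ∀ p q : ℚ, ∀ᵐ x : ℝ, a < p → (q : ℝ) < b → x ∈ Icc (p : ℝ) q →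
      DifferentiableAt ℝ f x := by
    intro p q
    by_cases hpq : a < p ∧ (q : ℝ) < b ∧ p ≤ q
    · obtain ⟨hp, hq, hpq⟩ := hpq
      have hpq' : (p : ℝ) ≤ q := by exact_mod_cast hpq
      have hac : AbsolutelyContinuousOnInterval f p q := by
        rw [absolutelyContinuousOnInterval_iff]
        intro ε hε
        obtain ⟨δ, hδ, h⟩ := hf ε hε
        refine ⟨δ, hδ, fun I hI => h I.1 I.2 (fun i hi => ?_) hI.2⟩
        have := hI.1 i (by simpa using hi)
        rw [uIcc_of_le hpq'] at this
        exact ⟨Icc_subset_Ioo hp hq this.1, Icc_subset_Ioo hp hq this.2⟩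
      filter_upwards [hac.ae_differentiableAt] with x hx _ _ hxm
      exact hx (by rwa [uIcc_of_le hpq'])
    · refine ae_of_all _ fun x hp hq hx => (hpq ⟨hp, hq, ?_⟩).elim
      exact_mod_cast hx.1.trans hx.2
  rw [ae_restrict_iff' measurableSet_Ioo]
  filter_upwards [ae_all_iff.2 fun p => ae_all_iff.2 (h p)] with x hx hxm
  obtain ⟨p, hp1, hp2⟩ := exists_rat_btwn hxm.1
  obtain ⟨q, hq1, hq2⟩ := exists_rat_btwn hxm.2
  exact hx p q hp1 hq2 ⟨hp2.le, hq1.le⟩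

theorem lintegral_ofReal_lt_top_of_ae_le {α : Type*} [MeasurableSpace α] {μ : Measure α}
    [IsFiniteMeasure μ] {f : α → ℝ} {c : ℝ} (hfc : ∀ᵐ x ∂μ, f x ≤ c) :
    ∫⁻ x, ENNReal.ofReal (f x) ∂μ < ⊤ :=
  (lintegral_mono_ae (hfc.mono fun _ hx => ENNReal.ofReal_le_ofReal hx)).trans_lt
    (lintegral_const_lt_top ENNReal.ofReal_ne_top)

theorem extIntegral_le_of_ae_le {α : Type*} [MeasurableSpace α] {μ : Measure α}
    [IsProbabilityMeasure μ] {f : α → ℝ} (hf : Measurable f) {c : ℝ} (hfc : ∀ᵐ x ∂μ, f x ≤ c) :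
    extIntegral μ f ≤ (c : EReal) := by
  have hpos := lintegral_ofReal_lt_top_of_ae_le hfc
  by_cases hneg : ∫⁻ x, ENNReal.ofReal (-f x) ∂μ = ⊤
  -- Here the extended integral is `-∞`.
  · simp [extIntegral, hneg]
  have hint : Integrable f μ := by
    refine ⟨hf.aestronglyMeasurable, ?_⟩
    have : ∀ x, ‖f x‖ₑ = ENNReal.ofReal (f x) + ENNReal.ofReal (-f x) := by
      intro x
      rw [Real.enorm_eq_ofReal_abs]
      rcases le_total 0 (f x) with h | h
      · rw [abs_of_nonneg h, ENNReal.ofReal_of_nonpos (p := -f x) (by linarith), add_zero]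
      · rw [abs_of_nonpos h, ENNReal.ofReal_of_nonpos h, zero_add]
    simp only [HasFiniteIntegral, this]
    rw [lintegral_add_left hf.ennreal_ofReal]
    exact ENNReal.add_lt_top.2 ⟨hpos, lt_top_iff_ne_top.2 hneg⟩
  have h1 : ∫ x, f x ∂μ ≤ c := by
    simpa using integral_mono_ae hint (integrable_const c) hfc
  rw [integral_eq_lintegral_pos_part_sub_lintegral_neg_part hint] at h1
  rw [extIntegral, ← ENNReal.ofReal_toReal hpos.ne, ← ENNReal.ofReal_toReal hneg,
    EReal.coe_ennreal_ofReal, EReal.coe_ennreal_ofReal, max_eq_left ENNReal.toReal_nonneg,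
    max_eq_left ENNReal.toReal_nonneg]
  exact_mod_cast h1

/-! ### Consequences of the structural assumptions. -/

theorem fenchelConj_zero {V : Type*} [NormedAddCommGroup V] [NormedSpace ℝ V] {Ψ : V → ℝ}
    (hΨ : IsAdmissiblePotential Ψ) : fenchelConj Ψ 0 = 0 := by
  refine le_antisymm (iSup_le fun v => ?_) (le_iSup_of_le 0 ?_)
  · have := hΨ.nonneg v
    simp only [zero_apply, zero_sub]
    exact_mod_cast neg_nonpos.2 this
  · simp [hΨ.zero]

/-- Freezing the other variables at zero isolates one summand, which thus inherits measurability
from the whole integrand. -/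
theorem dissipationIntegrand_left {V : Type*} [NormedAddCommGroup V] [NormedSpace ℝ V]
    {Ψ : V → V → ℝ} {u : ℝ → V} {t : ℝ} (hΨ : IsAdmissiblePotential (Ψ (u t))) (v : V) :
    dissipationIntegrand Ψ u t (v, 0, 0) = ENNReal.ofReal (Ψ (u t) v) := by
  simp [dissipationIntegrand, fenchelConj_zero hΨ]

theorem dissipationIntegrand_right {V : Type*} [NormedAddCommGroup V] [NormedSpace ℝ V]
    {Ψ : V → V → ℝ} {u : ℝ → V} {t : ℝ} (hΨ : IsAdmissiblePotential (Ψ (u t)))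
    (ζ : StrongDual ℝ V) :
    dissipationIntegrand Ψ u t (0, ζ, 0) = (fenchelConj (Ψ (u t)) (-ζ)).toENNReal := by
  simp [dissipationIntegrand, hΨ.zero]

section

variable {V : Type*} [NormedAddCommGroup V] [NormedSpace ℝ V]
  {T : ℝ} {D : Set V} {E : ℝ → V → EReal} {Ψ : V → V → ℝ}
  {F : ℝ → V → Set (StrongDual ℝ V)} {P : ℝ → V → StrongDual ℝ V → ℝ}

/-- A curve of bounded energy stays in a sublevel of `sup_t E_t`. -/
theorem EnergyAssumptions.exists_supEnergy_le [MeasurableSpace V]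
    (hE : EnergyAssumptions T D E Ψ F P) {u : ℝ → V}
    (hbdd : ∃ S : ℝ, ∀ t ∈ Ioo 0 T, E t (u t) ≤ (S : EReal)) :
    ∃ R > (0 : ℝ), ∀ t ∈ Ioo 0 T, u t ∈ D ∧ supEnergy T E (u t) ≤ (R : EReal) := by
  obtain ⟨S, hS⟩ := hbdd
  obtain ⟨C₀, hC₀, hlow⟩ := hE.bounded_below
  obtain ⟨C₁, hC₁, hlip⟩ := hE.lipschitz
  -- The Lipschitz bound in time gives `E_s ≤ E_t + C₁ E_t |t - s|`; the `max` only secures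
  -- positivity.
  refine ⟨max 1 (S + C₁ * S * T), by positivity, fun t ht => ?_⟩
  have htI : t ∈ Icc 0 T := Ioo_subset_Icc_self ht
  have hD : u t ∈ D := by
    rw [← hE.dom_energy t htI]
    exact (hS t ht).trans_lt (EReal.coe_lt_top S)
  have hreal : ∀ s ∈ Icc 0 T, (((E s (u t)).toReal : ℝ) : EReal) = E s (u t) := by
    intro s hs
    have h1 : u t ∈ {x | E s x < ⊤} := by rwa [hE.dom_energy s hs]
    exact EReal.coe_toReal h1.ne ((EReal.bot_lt_coe C₀).trans_le (hlow s hs _ hD)).ne'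
  refine ⟨hD, iSup₂_le fun s hs => ?_⟩
  have htS : (E t (u t)).toReal ≤ S := by
    have := hS t ht
    rw [← hreal t htI] at this
    exact_mod_cast this
  have ht0 : 0 ≤ (E t (u t)).toReal := by
    have := hlow t htI _ hD
    rw [← hreal t htI] at this
    exact hC₀.le.trans (by exact_mod_cast this)
  have hts : |t - s| ≤ T := by
    rw [abs_le]
    constructor <;> linarith [ht.1, ht.2, hs.1, hs.2]
  have h2 := (abs_le.1 (hlip _ hD t htI s hs)).1
  have h3 : C₁ * (E t (u t)).toReal * |t - s| ≤ C₁ * S * T := by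
    have := ht0.trans htS
    gcongr
  rw [← hreal s hs]
  exact_mod_cast le_max_of_le_right (by linarith)

/-- Uniform linear lower bounds for the dissipation along a curve of bounded energy. -/
theorem DissipationAssumptions.exists_enorm_le (hΨ : DissipationAssumptions T D E Ψ) {R : ℝ}
    (hR : 0 < R) :
    ∃ K : ℝ, ∀ x ∈ D, supEnergy T E x ≤ (R : EReal) →
      (∀ v : V, ‖v‖ₑ ≤ ENNReal.ofReal K + ENNReal.ofReal (Ψ x v)) ∧
      ∀ ξ : StrongDual ℝ V, ‖ξ‖ₑ ≤ ENNReal.ofReal K + (fenchelConj (Ψ x) (-ξ)).toENNReal := by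
  obtain ⟨K₁, hK₁, h₁⟩ := hΨ.superlinear R hR 1 one_pos
  obtain ⟨K₂, hK₂, h₂⟩ := hΨ.conj_superlinear R hR 1 one_pos
  refine ⟨max K₁ K₂, fun x hx hxR => ⟨fun v => ?_, fun ξ => ?_⟩⟩
  · rw [← ofReal_norm]
    rcases le_total K₁ ‖v‖ with h | h
    · refine le_add_left (ENNReal.ofReal_le_ofReal ?_)
      simpa using h₁ x hx hxR v h
    · exact le_add_right (ENNReal.ofReal_le_ofReal (le_max_of_le_left h))
  · rw [← ofReal_norm]
    rcases le_total K₂ ‖ξ‖ with h | h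
    · refine le_add_left ?_
      have := h₂ x hx hxR (-ξ) (by simpa using h)
      simpa using EReal.toENNReal_le_toENNReal this
    · exact le_add_right (ENNReal.ofReal_le_ofReal (le_max_of_le_right h))

/-- The set of triples `(t, x, (v, ζ, p))` with `ζ ∈ F_t(x)` and `p ≤ P_t(x, ζ)` is Borel. -/
theorem EnergyAssumptions.measurableSet_le_timeDeriv [MeasurableSpace V]
    (hE : EnergyAssumptions T D E Ψ F P) :
    MeasurableSet {q : ℝ × V × (V × StrongDual ℝ V × ℝ) |
      q.2.2.2.1 ∈ F q.1 q.2.1 ∧ q.2.2.2.2 ≤ P q.1 q.2.1 q.2.2.2.1} := by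
  -- `P` is Borel only on the graph, so a Borel extension replaces it.
  obtain ⟨G, hG, hGP⟩ := (MeasurableEmbedding.subtype_coe hE.graph_borel).exists_measurable_extend
    hE.time_deriv_borel (fun _ => ⟨0⟩)
  have hG' : ∀ t x, ∀ ζ ∈ F t x, G (t, x, ζ) = P t x ζ := fun t x ζ h =>
    congrFun hGP ⟨(t, x, ζ), h⟩
  let φ : ℝ × V × (V × StrongDual ℝ V × ℝ) → ℝ × V × StrongDual ℝ V :=
    fun q => (q.1, q.2.1, q.2.2.2.1)
  have hφ : Measurable φ := by fun_prop
  have : {q : ℝ × V × (V × StrongDual ℝ V × ℝ) |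
      q.2.2.2.1 ∈ F q.1 q.2.1 ∧ q.2.2.2.2 ≤ P q.1 q.2.1 q.2.2.2.1} =
      φ ⁻¹' multiGraph F ∩ {q | q.2.2.2.2 ≤ G (φ q)} := by
    ext q
    refine and_congr_right fun h => ?_
    change _ ↔ q.2.2.2.2 ≤ G (φ q)
    rw [hG' _ _ _ h]
  rw [this]
  exact (hφ hE.graph_borel).inter (measurableSet_le (by fun_prop) (hG.comp hφ))

end

/-! ### The chain rule for Young measures. -/

theorem propositionB1
    {V : Type*} [NormedAddCommGroup V] [NormedSpace ℝ V] [CompleteSpace V]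
    [TopologicalSpace.SeparableSpace V] [MeasurableSpace V] [BorelSpace V]
    (hV : IsReflexiveSpace V)
    (T : ℝ) (hT : 0 < T)
    (D : Set V) (E : ℝ → V → EReal) (Ψ : V → V → ℝ)
    (F : ℝ → V → Set (StrongDual ℝ V)) (P : ℝ → V → StrongDual ℝ V → ℝ)
    (hΨ : DissipationAssumptions T D E Ψ)
    (hE : EnergyAssumptions T D E Ψ F P)
    (u : ℝ → V) (hu : AbsolutelyContinuousOnInterval u 0 T)
    (hdom : ∀ᵐ t ∂(volume.restrict (Ioo 0 T)), (F t (u t)).Nonempty)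
    (hbdd : ∃ S : ℝ, ∀ t ∈ Ioo 0 T, E t (u t) ≤ (S : EReal))
    (μ : ℝ → Measure (V × StrongDual ℝ V × ℝ)) (hμ : IsYoungMeasure T μ)
    (hmeas : ∃ g : ℝ × (V × StrongDual ℝ V × ℝ) → ENNReal, Measurable g ∧
      ∀ᵐ t ∂(volume.restrict (Ioo 0 T)), ∀ w, dissipationIntegrand Ψ u t w = g (t, w))
    (hfin : ∫⁻ t in Ioo 0 T, ∫⁻ w, dissipationIntegrand Ψ u t w ∂(μ t) < ⊤)
    (hbary : ∀ᵐ t ∂(volume.restrict (Ioo 0 T)), deriv u t = ∫ w, w.1 ∂(μ t))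
    (hsupp : ∀ᵐ t ∂(volume.restrict (Ioo 0 T)), ∀ w ∈ (μ t).support,
      w.2.1 ∈ F t (u t) ∧ w.2.2 ≤ P t (u t) w.2.1) :
    AbsContOnIoo (energyAlong E u) 0 T ∧
      ∀ᵐ t ∂(volume.restrict (Ioo 0 T)),
        DifferentiableAt ℝ (energyAlong E u) t ∧
        ∫⁻ w, ENNReal.ofReal (w.2.1 (deriv u t) + w.2.2) ∂(μ t) < ⊤ ∧
        extIntegral (μ t) (fun w => w.2.1 (deriv u t) + w.2.2)
          ≤ ((deriv (energyAlong E u) t : ℝ) : EReal) := by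
  have hsepD := hV.separableSpace_strongDual
  have hscV : SecondCountableTopology V := UniformSpace.secondCountable_of_separable V
  have hscD : SecondCountableTopology (StrongDual ℝ V) :=
    UniformSpace.secondCountable_of_separable _
  set ν : Measure ℝ := volume.restrict (Ioo 0 T)
  have hmem : ∀ᵐ t ∂ν, t ∈ Ioo 0 T := ae_restrict_mem measurableSet_Ioo
  obtain ⟨R, hR, huR⟩ := hE.exists_supEnergy_le hbdd
  obtain ⟨K, hK⟩ := hΨ.exists_enorm_le hR
  obtain ⟨g, hg, hgΨ⟩ := hmeas
  obtain ⟨f, hf, hfμ⟩ := hμ.exists_measurable_map_eq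
  have hft : ∀ t, Measurable (f t) := fun t => hf.of_uncurry_left
  have hfs : ∀ s, Measurable fun t => f t s := fun s => hf.of_uncurry_right
  have hgf : Measurable fun q : ℝ × unitInterval => g (q.1, f q.1 q.2) :=
    hg.comp (measurable_fst.prodMk hf)
  have hgint : ∀ᵐ t ∂ν, ∫⁻ w, dissipationIntegrand Ψ u t w ∂(μ t) = ∫⁻ s, g (t, f t s) := by
    filter_upwards [hgΨ, hfμ] with t h1 h2
    rw [lintegral_congr h1, ← h2, lintegral_map (f := fun w => g (t, w)) (by fun_prop) (hft t)]
  have hgfin : ∫⁻ t, (∫⁻ s, g (t, f t s)) ∂ν < ⊤ := by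
    rwa [← lintegral_congr_ae hgint]
  have hvel : HasFiniteTimeIntegral T (fun t => ENNReal.ofReal (Ψ (u t) (deriv u t))) := by
    refine ⟨⟨fun t => g (t, deriv u t, 0, 0), by fun_prop, ?_⟩, lt_of_le_of_lt
      (lintegral_mono_ae ?_) hfin⟩
    · filter_upwards [hgΨ, hmem] with t h1 ht
      rw [← h1, dissipationIntegrand_left (hΨ.admissible _ (huR t ht).1)]
    · filter_upwards [hgint, ae_lt_top hgf.lintegral_prod_right' hgfin.ne, hbary, hmem]
        with t h1 h2 h3 ht
      have := hμ.prob t ht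
      obtain ⟨htD, htR⟩ := huR t ht
      have hΨt := hΨ.admissible _ htD
      -- Needed for Jensen: without integrability the Bochner integral would be the default `0`.
      have hint : Integrable (fun w : V × StrongDual ℝ V × ℝ => w.1) (μ t) := by
        refine ⟨measurable_fst.aestronglyMeasurable, ?_⟩
        refine lt_of_le_of_lt (lintegral_mono fun w => ((hK _ htD htR).1 w.1).trans
          (add_le_add_right (le_self_add : _ ≤ dissipationIntegrand Ψ u t w) _)) ?_
        rw [lintegral_add_left measurable_const]
        change _ + ∫⁻ w, dissipationIntegrand Ψ u t w ∂(μ t) < ⊤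
        rw [h1]
        exact ENNReal.add_lt_top.2 ⟨lintegral_const_lt_top ENNReal.ofReal_ne_top, h2⟩
      rw [h3]
      exact (hΨt.convex.ofReal_map_integral_le hΨt.lsc hint).trans
        (lintegral_mono fun w => le_self_add)
  have hsel : ∀ᵐ s : unitInterval, ∀ᵐ t ∂ν,
      (f t s).2.1 ∈ F t (u t) ∧ (f t s).2.2 ≤ P t (u t) (f t s).2.1 := by
    -- `u` is controlled only on `[0,T]`; a measurable version makes the exceptional set measurable
    -- for Fubini.
    have hum : AEMeasurable u ν :=
      (hu.continuousOn.mono (by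
        rw [uIcc_of_le hT.le]; exact Ioo_subset_Icc_self)).aemeasurable measurableSet_Ioo
    let φ : ℝ × unitInterval → ℝ × V × (V × StrongDual ℝ V × ℝ) :=
      fun q => (q.1, hum.mk u q.1, f q.1 q.2)
    have hφ : Measurable φ :=
      measurable_fst.prodMk ((hum.measurable_mk.comp measurable_fst).prodMk hf)
    have h : ∀ᵐ t ∂ν, ∀ᵐ s : unitInterval, (f t s).2.1 ∈ F t (hum.mk u t) ∧
        (f t s).2.2 ≤ P t (hum.mk u t) (f t s).2.1 := by
      filter_upwards [hsupp, hfμ, hum.ae_eq_mk] with t h1 h2 h3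
      have h4 : ∀ᵐ w ∂(μ t), w ∈ (μ t).support := Measure.support_mem_ae
      have h5 : ∀ᵐ w ∂(volume.map (f t)), w ∈ (μ t).support := by rwa [h2]
      filter_upwards [ae_of_ae_map (hft t).aemeasurable h5] with s hs
      rw [← h3]
      exact h1 _ hs
    rw [Measure.ae_ae_comm (p := fun t s => (f t s).2.1 ∈ F t (hum.mk u t) ∧
      (f t s).2.2 ≤ P t (hum.mk u t) (f t s).2.1) (hφ hE.measurableSet_le_timeDeriv)] at h
    filter_upwards [h] with s hs
    filter_upwards [hs, hum.ae_eq_mk] with t h1 h2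
    rwa [h2]
  have hslice : ∀ᵐ s : unitInterval, ∫⁻ t, g (t, f t s) ∂ν < ⊤ := by
    rw [lintegral_lintegral_swap hgf.aemeasurable] at hgfin
    exact ae_lt_top hgf.lintegral_prod_left' hgfin.ne
  have hchain : ∀ᵐ s : unitInterval, AbsContOnIoo (energyAlong E u) 0 T ∧
      ∀ᵐ t ∂ν, (f t s).2.1 (deriv u t) + (f t s).2.2 ≤ deriv (energyAlong E u) t := by
    filter_upwards [hsel, hslice] with s h1 h2
    have hξm : Measurable fun t => (f t s).2.1 := (hfs s).snd.fst
    have hconj : ∀ᵐ t ∂ν, (fenchelConj (Ψ (u t)) (-(f t s).2.1)).toENNReal ≤ g (t, f t s) := by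
      filter_upwards [hgΨ] with t h
      rw [← h]
      exact le_add_self
    have hξ : HasFiniteTimeIntegral T
        (fun t => (fenchelConj (Ψ (u t)) (-(f t s).2.1)).toENNReal) := by
      refine ⟨⟨fun t => g (t, 0, (f t s).2.1, 0), by fun_prop, ?_⟩,
        (lintegral_mono_ae hconj).trans_lt h2⟩
      filter_upwards [hgΨ, hmem] with t h ht
      rw [← h, dissipationIntegrand_right (hΨ.admissible _ (huR t ht).1)]
    have hint : Integrable (fun t => (f t s).2.1) ν := by
      refine ⟨hξm.aestronglyMeasurable, ?_⟩
      refine lt_of_le_of_lt (lintegral_mono_ae (g := fun t => ENNReal.ofReal K +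
        (fenchelConj (Ψ (u t)) (-(f t s).2.1)).toENNReal) ?_) ?_
      · filter_upwards [hmem] with t ht
        exact (hK _ (huR t ht).1 (huR t ht).2).2 _
      · rw [lintegral_add_left measurable_const]
        exact ENNReal.add_lt_top.2 ⟨lintegral_const_lt_top ENNReal.ofReal_ne_top, hξ.2⟩
    obtain ⟨hac, hder⟩ := hE.chain_rule u (fun t => (f t s).2.1) hu hint hbdd
      (h1.mono fun _ h => h.1) hvel hξ
    refine ⟨hac, ?_⟩
    filter_upwards [hder, h1] with t h3 h4
    linarith [h4.2]
  -- Absolute continuity does not involve `s`, so one good `s` suffices.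
  obtain ⟨s₀, hac, -⟩ := hchain.exists
  refine ⟨hac, ?_⟩
  have hder : ∀ᵐ s : unitInterval, ∀ᵐ t ∂ν,
      (f t s).2.1 (deriv u t) + (f t s).2.2 ≤ deriv (energyAlong E u) t :=
    hchain.mono fun _ h => h.2
  have happ : Measurable fun q : StrongDual ℝ V × V => q.1 q.2 :=
    isBoundedBilinearMap_apply.continuous.measurable
  have hset : MeasurableSet {q : ℝ × unitInterval |
      (f q.1 q.2).2.1 (deriv u q.1) + (f q.1 q.2).2.2 ≤ deriv (energyAlong E u) q.1} := by
    refine measurableSet_le (Measurable.add (happ.comp (hf.snd.fst.prodMk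
      ((measurable_deriv u).comp measurable_fst))) hf.snd.snd)
      ((measurable_deriv _).comp measurable_fst)
  rw [← Measure.ae_ae_comm hset] at hder
  filter_upwards [hder, hfμ, hac.ae_differentiableAt, hmem] with t h1 h2 h3 ht
  have := hμ.prob t ht
  have hm : Measurable fun w : V × StrongDual ℝ V × ℝ => w.2.1 (deriv u t) + w.2.2 :=
    (happ.comp (measurable_snd.fst.prodMk measurable_const)).add measurable_snd.snd
  have hle : ∀ᵐ w ∂(μ t), w.2.1 (deriv u t) + w.2.2 ≤ deriv (energyAlong E u) t := by
    rw [← h2, ae_map_iff (hft t).aemeasurable (measurableSet_le hm measurable_const)]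
    exact h1
  exact ⟨h3, lintegral_ofReal_lt_top_of_ae_le hle, extIntegral_le_of_ae_le hm hle⟩
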